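/- For a finite simple graph $\Gamma$ with vertex set $X$, let $\mathbb{G}(\Gamma)$ be the partially commutative group with commutation graph $\Gamma$, that is, the group with generating set $X$ and defining relations $[x,y]=x^{-1}y^{-1}xy=1$ for all edges $\{x,y\}$ of $\Gamma$. Let $C_n$ be the cycle graph on $n$ vertices, $P_m$ the path graph with $m$ edges (hence $m+1$ vertices), and $\overline{\Gamma}$ the complement of $\Gamma$. A graph is weakly chordal if, for every $k\ge 5$, it contains neither $C_k$ nor $\overline{C}_k$ as an induced subgraph. A group embeds in another if there is an injective homomorphism from the first to the second. For all integers $n\ge 5$ and $m\ge 7$: the group $\mathbb{G}(C_n)$ embeds in $\mathbb{G}(C_5)$, and $\mathbb{G}(C_5)\cong\mathbb{G}(\overline{C}_5)$; the group $\mathbb{G}(\overline{P}_7)$ embeds in $\mathbb{G}(\overline{P}_m)$; and the group $\mathbb{G}(C_n)$ embeds in $\mathbb{G}(\overline{P}_m)$. Moreover, the graph $\overline{P}_m$ is weakly chordal. -/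

import Mathlib

/-- The relators `[x, y] = x⁻¹ y⁻¹ x y` in the free group on the vertices, one for every ordered
pair of adjacent vertices. -/
def pcRelators {V : Type*} (Γ : SimpleGraph V) : Set (FreeGroup V) :=
  {r | ∃ x y : V, Γ.Adj x y ∧
    r = (FreeGroup.of x)⁻¹ * (FreeGroup.of y)⁻¹ * FreeGroup.of x * FreeGroup.of y}

/-- The partially commutative group `𝔾(Γ)` with commutation graph `Γ`: generators are the
vertices, and two generators commute when they are joined by an edge of `Γ`. -/
abbrev PCGroup {V : Type*} (Γ : SimpleGraph V) : Type _ :=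
  PresentedGroup (pcRelators Γ)

/-- The group `G` embeds in the group `H`. -/
def GroupEmbeds (G H : Type*) [Group G] [Group H] : Prop :=
  ∃ f : G →* H, Function.Injective f

/-- A graph is weakly chordal if it contains neither the cycle `C_k` nor its complement as an
induced subgraph, for every `k ≥ 5`. -/
def IsWeaklyChordal {V : Type*} (Γ : SimpleGraph V) : Prop :=
  ∀ k : ℕ, 5 ≤ k →
    ¬ (SimpleGraph.cycleGraph k).IsIndContained Γ ∧
    ¬ ((SimpleGraph.cycleGraph k)ᶜ).IsIndContained Γ

/-- The path `P_m` with `m` edges, that is, with `m + 1` vertices. -/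
abbrev pathWithEdges (m : ℕ) : SimpleGraph (Fin (m + 1)) :=
  SimpleGraph.pathGraph (m + 1)

/-!
The two substantial embeddings are `𝔾(C_n) → 𝔾(C_5)` and `𝔾(C_5) → 𝔾(P̄_7)`.

**From the pentagon to the complement of a path.** Both graphs are best seen through their
complements: let `v₁, …, v₅` be the vertices of the pentagon `C̄_5 ≅ C_5` in cyclic order and
`x₁, …, x₈` those of `P_7`, so that precisely consecutive generators fail to commute. Winding the
path around the pentagon suggests the map `v₁ ↦ x₁x₆`, `v₂ ↦ x₂x₇`, `v₃ ↦ x₃x₈`, `v₄ ↦ x₄`,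
`v₅ ↦ x₅`. On `⟨v₁, v₂, v₃⟩` it is the diagonal map to two commuting copies of that group, which
is split by either projection (`PCGroup.diagonal`). Adding a vertex to a graph is an HNN extension
whose stable letter centralizes the subgroup generated by its neighbours
(`PCGroup.addVertexEquiv`), and `v₄ ↦ x₄`, `v₅ ↦ x₅` match stable letters. By Britton's lemma, a
map of such extensions is injective as soon as it is injective on the base and the associated
subgroup of the source is the full preimage of that of the target
(`HNNExtension.mapRefl_injective`). The preimage condition holds because each projection carries
one of the two associated subgroups of the target back to that of the source
(`PCGroup.comap_diagonal_ne_inl`, `PCGroup.comap_diagonal_ne_inr`).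

**From long cycles to the pentagon.** The double of `Γ` over the star of a vertex `v` consists of
two copies of `Γ` glued along `v` and its neighbours. Its group embeds in `𝔾(Γ)` through `v ↦ v²`,
`x ↦ x` on the first copy and `x' ↦ v x v⁻¹` on the second (`PCGroup.Double.groupEmbeds`):
adjoining a square root of `v` to the group of the double gives an action of `𝔾(Γ)` on two cosets,
under which the image of the double acts on the first coset by left multiplication. If a pentagon
shares a path with three edges with `C_n`, then doubling over an inner vertex of that path yields
the same configuration with `C_{n+1}` (`eared_succ_embedding`), and doubling `C_5` itself yields the
configuration with `C_6`.

Weak chordality of `P̄_m` is a statement about induced cycles and cycle complements in `P_m`: the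
former are excluded since `P_m` is a path, the latter since it is bipartite.
-/

/-! ### Homomorphisms between partially commutative groups -/

namespace PCGroup

variable {V W G : Type*} [Group G] {Γ : SimpleGraph V} {Δ : SimpleGraph W}

theorem commute_of_adj {x y : V} (h : Γ.Adj x y) :
    Commute (PresentedGroup.of x : PCGroup Γ) (PresentedGroup.of y) := by
  have h1 : PresentedGroup.mk (pcRelators Γ)
      ((FreeGroup.of x)⁻¹ * (FreeGroup.of y)⁻¹ * FreeGroup.of x * FreeGroup.of y) = 1 :=
    PresentedGroup.one_of_mem ⟨x, y, h, rfl⟩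
  simp only [map_mul, map_inv] at h1
  rw [mul_assoc, ← mul_inv_rev, inv_mul_eq_one] at h1
  exact h1.symm

/-- The homomorphism out of `𝔾(Γ)` given by images of the vertices that commute along edges. -/
def lift (f : V → G) (hf : ∀ x y, Γ.Adj x y → Commute (f x) (f y)) : PCGroup Γ →* G :=
  PresentedGroup.toGroup (f := f) (by
    rintro r ⟨x, y, h, rfl⟩
    simp only [map_mul, map_inv, FreeGroup.lift_apply_of]
    rw [mul_assoc, ← mul_inv_rev, inv_mul_eq_one]
    exact (hf x y h).symm)

@[simp]
theorem lift_of (f : V → G) (hf : ∀ x y, Γ.Adj x y → Commute (f x) (f y)) (x : V) :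
    lift f hf (PresentedGroup.of x) = f x :=
  PresentedGroup.toGroup.of _

/-- The homomorphism `𝔾(Γ) → 𝔾(Δ)` induced by a map of graphs. -/
def map (e : Γ →g Δ) : PCGroup Γ →* PCGroup Δ :=
  lift (fun x => PresentedGroup.of (e x)) fun _ _ h => commute_of_adj (e.map_adj h)

@[simp]
theorem map_of (e : Γ →g Δ) (x : V) :
    map e (PresentedGroup.of x) = PresentedGroup.of (e x) :=
  lift_of _ _ x

/-- The homomorphism is split by the retraction killing the vertices outside the subgraph. -/
theorem map_injective (e : Γ ↪g Δ) : Function.Injective (map e.toHom) := by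
  classical
  let r : PCGroup Δ →* PCGroup Γ :=
    lift (fun y => if h : ∃ x, e x = y then PresentedGroup.of h.choose else 1) (by
      intro y z hyz
      by_cases hy : ∃ x, e x = y
      · by_cases hz : ∃ x, e x = z
        · simp only [hy, hz, dif_pos]
          refine commute_of_adj ?_
          rw [← e.map_adj_iff, hy.choose_spec, hz.choose_spec]
          exact hyz
        · simp [hz]
      · simp [hy])
  have hr : r.comp (map e.toHom) = MonoidHom.id _ := by
    apply PresentedGroup.ext
    intro x
    simp [r]
  intro a b hab
  simpa [← MonoidHom.comp_apply, hr] using congrArg r hab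

theorem groupEmbeds_of_embedding (e : Γ ↪g Δ) : GroupEmbeds (PCGroup Γ) (PCGroup Δ) :=
  ⟨map e.toHom, map_injective e⟩

/-- Isomorphic graphs have isomorphic groups. -/
def congr (e : Γ ≃g Δ) : PCGroup Γ ≃* PCGroup Δ :=
  MonoidHom.toMulEquiv (map e.toEmbedding.toHom) (map e.symm.toEmbedding.toHom)
    (by apply PresentedGroup.ext; intro x; simp)
    (by apply PresentedGroup.ext; intro x; simp)

end PCGroup

theorem GroupEmbeds.trans {G H K : Type*} [Group G] [Group H] [Group K]
    (h₁ : GroupEmbeds G H) (h₂ : GroupEmbeds H K) : GroupEmbeds G K := by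
  obtain ⟨f, hf⟩ := h₁
  obtain ⟨g, hg⟩ := h₂
  exact ⟨g.comp f, hg.comp hf⟩

/-! ### HNN extensions with trivial twist -/

namespace HNNExtension

variable {A B : Type*} [Group A] [Group B] {S : Subgroup A} {T : Subgroup B}

/-- The map between HNN extensions with trivial twist (the stable letter centralizes the
associated subgroup) that extends `f` and fixes the stable letter. -/
def mapRefl (f : A →* B) (h : S ≤ T.comap f) :
    HNNExtension A S S (MulEquiv.refl S) →* HNNExtension B T T (MulEquiv.refl T) :=
  lift (of.comp f) t fun a => t_mul_of (φ := MulEquiv.refl T) ⟨f a, h a.2⟩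

@[simp]
theorem mapRefl_of (f : A →* B) (h : S ≤ T.comap f) (a : A) :
    mapRefl f h (of a) = of (f a) :=
  lift_of _ _ _ a

@[simp]
theorem mapRefl_t (f : A →* B) (h : S ≤ T.comap f) : mapRefl f h t = t :=
  lift_t _ _ _

theorem toSubgroup_self (u : ℤˣ) : toSubgroup S S u = S := by
  rcases Int.units_eq_one_or u with rfl | rfl <;> simp

theorem exists_reducedWord_prod_eq (φ : S ≃* S) (x : HNNExtension A S S φ) :
    ∃ w : NormalWord.ReducedWord A S S, w.prod φ = x := by
  obtain ⟨d⟩ := NormalWord.TransversalPair.nonempty A S S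
  exact ⟨(NormalWord.equiv φ d x).toReducedWord, (NormalWord.equiv φ d).symm_apply_apply x⟩

/-- A reduced word stays reduced under `mapRefl` when `S` is the whole preimage of `T`, so
Britton's lemma applies to its image. -/
theorem mem_range_of_mapRefl_mem_range (f : A →* B) (h : T.comap f = S)
    {x : HNNExtension A S S (MulEquiv.refl S)}
    (hx : mapRefl f h.ge x ∈ (of : B →* _).range) : x ∈ (of : A →* _).range := by
  obtain ⟨w, rfl⟩ := exists_reducedWord_prod_eq _ x
  let w' : NormalWord.ReducedWord B T T :=
    { head := f w.head
      toList := w.toList.map (Prod.map id f)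
      chain := by
        rw [List.isChain_map]
        refine w.chain.imp fun a b hab => ?_
        simp only [toSubgroup_self, Prod.map_fst, Prod.map_snd, id_eq] at hab ⊢
        intro ha
        exact hab (h ▸ ha) }
  have hw' : w'.prod (MulEquiv.refl T) = mapRefl f h.ge (w.prod (MulEquiv.refl S)) := by
    simp [w', NormalWord.ReducedWord.prod, map_list_prod, Function.comp_def]
  have hnil : w.toList = [] := by
    simpa [w'] using ReducedWord.toList_eq_nil_of_mem_of_range _ w' (hw' ▸ hx)
  exact ⟨w.head, by simp [NormalWord.ReducedWord.prod, hnil]⟩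

theorem mapRefl_injective (f : A →* B) (hf : Function.Injective f) (h : T.comap f = S) :
    Function.Injective (mapRefl f h.ge) := by
  rw [injective_iff_map_eq_one]
  intro x hx
  obtain ⟨a, rfl⟩ := mem_range_of_mapRefl_mem_range f h (x := x) (hx ▸ one_mem _)
  rw [mapRefl_of, ← map_one of] at hx
  rw [hf ((of_injective _ hx).trans (map_one f).symm), map_one]

end HNNExtension

/-! ### Adding a vertex to a graph -/

/-- The graph `Γ` with one more vertex, `none`, joined to the vertices in `L`. -/
def SimpleGraph.addVertex {V : Type*} (Γ : SimpleGraph V) (L : Set V) :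
    SimpleGraph (Option V) where
  Adj
    | none, none => False
    | none, some y => y ∈ L
    | some x, none => x ∈ L
    | some x, some y => Γ.Adj x y
  symm := ⟨by rintro (_ | x) (_ | y) h <;> first | exact h | exact SimpleGraph.Adj.symm (G := Γ) h⟩
  loopless := ⟨by rintro (_ | x) h; exacts [h, Γ.irrefl h]⟩

namespace SimpleGraph

variable {V : Type*} (Γ : SimpleGraph V) (L : Set V)

@[simp]
theorem addVertex_adj_none_some (y : V) : (Γ.addVertex L).Adj none (some y) ↔ y ∈ L := Iff.rfl

@[simp]
theorem addVertex_adj_some_none (x : V) : (Γ.addVertex L).Adj (some x) none ↔ x ∈ L := Iff.rfl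

@[simp]
theorem addVertex_adj_some_some (x y : V) :
    (Γ.addVertex L).Adj (some x) (some y) ↔ Γ.Adj x y := Iff.rfl

end SimpleGraph

namespace PCGroup

variable {V W : Type*} {Γ : SimpleGraph V} {Δ : SimpleGraph W} {L : Set V} {M : Set W}

/-- The subgroup generated by a set of vertices. -/
abbrev special (Γ : SimpleGraph V) (L : Set V) : Subgroup (PCGroup Γ) :=
  Subgroup.closure (PresentedGroup.of '' L)

/-- The inclusion of `𝔾(Γ)` in the group of the graph with one more vertex. -/
def base (Γ : SimpleGraph V) (L : Set V) : PCGroup Γ →* PCGroup (Γ.addVertex L) :=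
  map ⟨some, fun h => h⟩

@[simp]
theorem base_of (x : V) :
    base Γ L (PresentedGroup.of x) = PresentedGroup.of (some x) :=
  map_of _ x

theorem base_injective : Function.Injective (base Γ L) :=
  map_injective (Δ := Γ.addVertex L) ⟨⟨some, Option.some_injective V⟩, Iff.rfl⟩

theorem map_base_special (K : Set V) :
    (special Γ K).map (base Γ L) = special (Γ.addVertex L) (some '' K) := by
  rw [special, MonoidHom.map_closure, Set.image_image, special, Set.image_image]
  simp

/-- Adding a vertex is an HNN extension: the new generator is a stable letter that centralizes
the special subgroup on its neighbours. -/
def addVertexEquiv (Γ : SimpleGraph V) (L : Set V) :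
    PCGroup (Γ.addVertex L) ≃*
      HNNExtension (PCGroup Γ) (special Γ L) (special Γ L) (MulEquiv.refl _) :=
  MonoidHom.toMulEquiv
    (lift (fun o => o.elim HNNExtension.t fun x => HNNExtension.of (PresentedGroup.of x)) (by
      have key (x : V) (hx : x ∈ L) : Commute
          (HNNExtension.t : HNNExtension (PCGroup Γ) _ _ (MulEquiv.refl (special Γ L)))
          (HNNExtension.of (PresentedGroup.of x)) :=
        HNNExtension.t_mul_of (φ := MulEquiv.refl (special Γ L))
          ⟨_, Subgroup.subset_closure ⟨x, hx, rfl⟩⟩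
      rintro (_ | x) (_ | y) h
      · exact h.elim
      · exact key y h
      · exact (key x h).symm
      · exact (commute_of_adj (Γ := Γ) h).map HNNExtension.of))
    (HNNExtension.lift (base Γ L) (PresentedGroup.of none) (by
      rintro ⟨a, ha⟩
      change Commute _ _
      induction ha using Subgroup.closure_induction with
      | mem a ha =>
        obtain ⟨x, hx, rfl⟩ := ha
        rw [base_of]
        exact commute_of_adj (show (Γ.addVertex L).Adj none (some x) from hx)
      | one => simp
      | mul a b _ _ ha hb => simpa using ha.mul_right hb
      | inv a _ ha => simpa using ha.inv_right))
    (by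
      apply PresentedGroup.ext
      rintro (_ | x) <;> simp)
    (by
      apply HNNExtension.hom_ext
      · apply PresentedGroup.ext
        intro x
        simp
      · simp)

@[simp]
theorem addVertexEquiv_base (g : PCGroup Γ) :
    addVertexEquiv Γ L (base Γ L g) = HNNExtension.of g := by
  rw [← MulEquiv.eq_symm_apply]
  simp [addVertexEquiv]

/-- An injection whose preimage of the special subgroup on `M` is the one on `L` extends to the
graphs with one more vertex, and the extension reflects membership in the base. -/
theorem exists_extension (f : PCGroup Γ →* PCGroup Δ) (hf : Function.Injective f)
    (h : (special Δ M).comap f = special Γ L) :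
    ∃ F : PCGroup (Γ.addVertex L) →* PCGroup (Δ.addVertex M), Function.Injective F ∧
      (∀ g, F (base Γ L g) = base Δ M (f g)) ∧
      ∀ g, F g ∈ (base Δ M).range → g ∈ (base Γ L).range := by
  let F := ((addVertexEquiv Δ M).symm.toMonoidHom.comp
    (HNNExtension.mapRefl f h.ge)).comp (addVertexEquiv Γ L).toMonoidHom
  have hF (g) : addVertexEquiv Δ M (F g) = HNNExtension.mapRefl f h.ge (addVertexEquiv Γ L g) := by
    simp [F]
  refine ⟨F, ?_, fun g => ?_, fun g => ?_⟩
  · exact ((addVertexEquiv Δ M).symm.injective.comp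
      (HNNExtension.mapRefl_injective f hf h)).comp (addVertexEquiv Γ L).injective
  · apply (addVertexEquiv Δ M).injective
    simp [hF]
  · rintro ⟨b, hb⟩
    obtain ⟨a, ha⟩ := HNNExtension.mem_range_of_mapRefl_mem_range f h
      (x := addVertexEquiv Γ L g) ⟨b, by rw [← hF, ← hb, addVertexEquiv_base]⟩
    exact ⟨a, (addVertexEquiv Γ L).injective (by rw [addVertexEquiv_base, ha])⟩

/-- Two new vertices, not joined to each other, can be added at once. -/
theorem groupEmbeds_addVertex_addVertex {L' : Set V} {M' : Set W}
    (f : PCGroup Γ →* PCGroup Δ) (hf : Function.Injective f)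
    (h : (special Δ M).comap f = special Γ L) (h' : (special Δ M').comap f = special Γ L') :
    GroupEmbeds (PCGroup ((Γ.addVertex L).addVertex (some '' L')))
      (PCGroup ((Δ.addVertex M).addVertex (some '' M'))) := by
  obtain ⟨F, hF, hbase, hrange⟩ := exists_extension f hf h
  obtain ⟨F', hF', -⟩ := exists_extension (L := some '' L') (M := some '' M') F hF (by
    rw [← map_base_special, ← map_base_special]
    ext g
    constructor
    · rintro ⟨b, hb, hbg⟩
      obtain ⟨a, rfl⟩ := hrange g ⟨b, hbg⟩
      refine ⟨a, ?_, rfl⟩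
      rw [hbase] at hbg
      rwa [base_injective hbg, SetLike.mem_coe, ← Subgroup.mem_comap, h'] at hb
    · rintro ⟨a, ha, rfl⟩
      refine ⟨f a, ?_, (hbase a).symm⟩
      rw [← h'] at ha
      exact ha)
  exact ⟨F', hF'⟩

/-- For a homomorphism with a left inverse `p`, preimages of special subgroups can be checked on
generators. -/
theorem comap_special_eq (f : PCGroup Γ →* PCGroup Δ) (p : PCGroup Δ →* PCGroup Γ)
    (hp : p.comp f = MonoidHom.id _)
    (hL : ∀ x ∈ L, f (PresentedGroup.of x) ∈ special Δ M)
    (hM : ∀ y ∈ M, p (PresentedGroup.of y) ∈ special Γ L) :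
    (special Δ M).comap f = special Γ L := by
  apply le_antisymm
  · intro a ha
    have h1 : special Δ M ≤ (special Γ L).comap p := by
      rw [Subgroup.closure_le]
      rintro _ ⟨y, hy, rfl⟩
      exact hM y hy
    have h2 := h1 ha
    rwa [Subgroup.mem_comap, ← MonoidHom.comp_apply, hp] at h2
  · rw [Subgroup.closure_le]
    rintro _ ⟨x, hx, rfl⟩
    exact hL x hx

end PCGroup

/-! ### The pentagon group in the group of the complement of a path -/

namespace PCGroup

/-- The diagonal homomorphism to the group of two copies of `Γᶜ`, all of whose vertices in
different copies commute. -/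
def diagonal {V : Type*} (Γ : SimpleGraph V) : PCGroup Γᶜ →* PCGroup (Γ ⊕g Γ)ᶜ :=
  lift (fun x => PresentedGroup.of (.inl x) * PresentedGroup.of (.inr x)) (by
    intro x y h
    have hne : x ≠ y := h.ne
    have hadj : ¬ Γ.Adj x y := ((SimpleGraph.compl_adj _ _ _).1 h).2
    refine Commute.mul_left (Commute.mul_right ?_ ?_) (Commute.mul_right ?_ ?_) <;>
      refine commute_of_adj ?_ <;> simp [hne, hadj])

/-- The projection to the first copy. -/
def fstCopy {V : Type*} (Γ : SimpleGraph V) : PCGroup (Γ ⊕g Γ)ᶜ →* PCGroup Γᶜ :=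
  lift (Sum.elim PresentedGroup.of 1) (by
    rintro (x | x) (y | y) h
    · refine commute_of_adj ?_
      simpa using h
    all_goals simp)

/-- The projection to the second copy. -/
def sndCopy {V : Type*} (Γ : SimpleGraph V) : PCGroup (Γ ⊕g Γ)ᶜ →* PCGroup Γᶜ :=
  lift (Sum.elim 1 PresentedGroup.of) (by
    rintro (x | x) (y | y) h
    on_goal 4 =>
      refine commute_of_adj ?_
      simpa using h
    all_goals simp)

theorem fstCopy_comp_diagonal {V : Type*} (Γ : SimpleGraph V) :
    (fstCopy Γ).comp (diagonal Γ) = MonoidHom.id _ := by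
  apply PresentedGroup.ext
  intro x
  simp [fstCopy, diagonal]

theorem sndCopy_comp_diagonal {V : Type*} (Γ : SimpleGraph V) :
    (sndCopy Γ).comp (diagonal Γ) = MonoidHom.id _ := by
  apply PresentedGroup.ext
  intro x
  simp [sndCopy, diagonal]

theorem diagonal_injective {V : Type*} (Γ : SimpleGraph V) :
    Function.Injective (diagonal Γ) :=
  Function.LeftInverse.injective (g := fstCopy Γ)
    fun a => DFunLike.congr_fun (fstCopy_comp_diagonal Γ) a

theorem comap_diagonal_ne_inl {V : Type*} (Γ : SimpleGraph V) (v : V) :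
    (special (Γ ⊕g Γ)ᶜ {y | y ≠ .inl v}).comap (diagonal Γ) = special Γᶜ {x | x ≠ v} := by
  refine comap_special_eq _ _ (fstCopy_comp_diagonal Γ) (fun x hx => ?_) ?_
  · rw [diagonal, lift_of]
    exact mul_mem (Subgroup.subset_closure ⟨_, by simpa using hx, rfl⟩)
      (Subgroup.subset_closure ⟨_, by simp, rfl⟩)
  · rintro (y | y) hy
    · simp only [fstCopy, lift_of, Sum.elim_inl]
      exact Subgroup.subset_closure ⟨_, by simpa using hy, rfl⟩
    · simp [fstCopy, one_mem]

theorem comap_diagonal_ne_inr {V : Type*} (Γ : SimpleGraph V) (v : V) :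
    (special (Γ ⊕g Γ)ᶜ {y | y ≠ .inr v}).comap (diagonal Γ) = special Γᶜ {x | x ≠ v} := by
  refine comap_special_eq _ _ (sndCopy_comp_diagonal Γ) (fun x hx => ?_) ?_
  · rw [diagonal, lift_of]
    exact mul_mem (Subgroup.subset_closure ⟨_, by simp, rfl⟩)
      (Subgroup.subset_closure ⟨_, by simpa using hx, rfl⟩)
  · rintro (y | y) hy
    · simp [sndCopy, one_mem]
    · simp only [sndCopy, lift_of, Sum.elim_inr]
      exact Subgroup.subset_closure ⟨_, by simpa using hy, rfl⟩

end PCGroup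

/-- The complement of the path with `7` edges contains the complement of two disjoint paths with
two edges together with the two middle vertices. -/
theorem pathCompl_embedding : Nonempty
    ((((SimpleGraph.pathGraph 3 ⊕g SimpleGraph.pathGraph 3)ᶜ.addVertex {y | y ≠ .inl 2}).addVertex
      (some '' {y | y ≠ .inr 0})) ↪g (pathWithEdges 7)ᶜ) := by
  let pos : Option (Option (Fin 3 ⊕ Fin 3)) → ℕ
    | none => 4
    | some none => 3
    | some (some (.inl i)) => i
    | some (some (.inr i)) => 5 + i
  have hlt (x) : pos x < 7 + 1 := by
    rcases x with _ | _ | x | x <;> dsimp only [pos] <;> omega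
  have hinj : Function.Injective pos := by
    rintro (_ | _ | x | x) (_ | _ | y | y) h <;> dsimp only [pos] at h
    all_goals first | rfl | omega | rw [Fin.ext (by omega : x.val = y.val)]
  refine ⟨⟨⟨fun x => ⟨pos x, hlt x⟩, fun x y h => hinj (Fin.mk.inj h)⟩, @fun x y => ?_⟩⟩
  change ((pathWithEdges 7)ᶜ).Adj ⟨pos x, hlt x⟩ ⟨pos y, hlt y⟩ ↔ _
  rw [SimpleGraph.compl_adj, SimpleGraph.pathGraph_adj, Ne, Fin.mk.injEq, hinj.eq_iff]
  rcases x with _ | _ | x | x <;> rcases y with _ | _ | y | y <;>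
    simp [pos, SimpleGraph.pathGraph_adj, Fin.ext_iff, -Fin.val_eq_zero_iff] <;> omega

/-- In the order `0, 2, 4, 1, 3` consecutive vertices of the pentagon do not commute. Thus `0, 2, 4`
span the complement of a path, to which `1` and `3` are added. -/
theorem cycleGraph_five_embedding : Nonempty
    (SimpleGraph.cycleGraph 5 ↪g (((SimpleGraph.pathGraph 3)ᶜ.addVertex {x | x ≠ 2}).addVertex
      (some '' {x | x ≠ 0}))) := by
  refine ⟨⟨⟨![some (some 0), some none, some (some 1), none, some (some 2)], ?_⟩, ?_⟩⟩
  · decide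
  · intro i j
    fin_cases i <;> fin_cases j <;>
      simp [SimpleGraph.pathGraph_adj, SimpleGraph.cycleGraph_adj'] <;> decide

theorem groupEmbeds_cycleGraph_five_pathCompl :
    GroupEmbeds (PCGroup (SimpleGraph.cycleGraph 5)) (PCGroup (pathWithEdges 7)ᶜ) := by
  obtain ⟨e₁⟩ := cycleGraph_five_embedding
  obtain ⟨e₂⟩ := pathCompl_embedding
  exact ((PCGroup.groupEmbeds_of_embedding e₁).trans
    (PCGroup.groupEmbeds_addVertex_addVertex _ (PCGroup.diagonal_injective _)
      (PCGroup.comap_diagonal_ne_inl _ _) (PCGroup.comap_diagonal_ne_inr _ _))).trans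
    (PCGroup.groupEmbeds_of_embedding e₂)

theorem pathCompl_embedding_of_le {k m : ℕ} (h : k ≤ m) :
    Nonempty ((pathWithEdges k)ᶜ ↪g (pathWithEdges m)ᶜ) := by
  refine ⟨⟨⟨Fin.castLE (by omega), Fin.castLE_injective _⟩, ?_⟩⟩
  intro i j
  simp [SimpleGraph.pathGraph_adj, Fin.ext_iff]

theorem cycleGraph_five_iso_compl :
    Nonempty (SimpleGraph.cycleGraph 5 ≃g (SimpleGraph.cycleGraph 5)ᶜ) := by
  refine ⟨⟨⟨fun i => 2 * i, fun i => 3 * i, by decide, by decide⟩, ?_⟩⟩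
  simp only [Equiv.coe_fn_mk, SimpleGraph.compl_adj, SimpleGraph.cycleGraph_adj']
  decide

/-! ### Weak chordality of complements of paths -/

/-- Paths are bipartite, hence contain no induced cycle complement, which has a closed walk of
length `3` or (for `k = 5`) `5`. -/
theorem not_isIndContained_pathGraph_of_cycleGraph_compl {k m : ℕ} (hk : 5 ≤ k) :
    ¬ ((SimpleGraph.cycleGraph k)ᶜ).IsIndContained (SimpleGraph.pathGraph m) := by
  rintro ⟨e⟩
  have key (i j : ℕ) (hi : i < k) (hj : j < k) (h1 : i + 2 ≤ j) (h2 : j + 2 ≤ i + k) :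
      (e ⟨i, hi⟩ : ℕ) + 1 = e ⟨j, hj⟩ ∨ (e ⟨j, hj⟩ : ℕ) + 1 = e ⟨i, hi⟩ := by
    have h : ((SimpleGraph.cycleGraph k)ᶜ).Adj ⟨i, hi⟩ ⟨j, hj⟩ := by
      rw [SimpleGraph.compl_adj, SimpleGraph.cycleGraph_adj', Fin.val_sub, Fin.val_sub,
        Ne, Fin.mk.injEq]
      dsimp only
      rw [Nat.mod_eq_of_lt (by omega : k - j + i < k),
        show k - i + j = (j - i) + k by omega, Nat.add_mod_right, Nat.mod_eq_of_lt (by omega)]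
      omega
    simpa [SimpleGraph.pathGraph_adj] using e.map_adj_iff.2 h
  -- The odd closed walk is `0, 2, 4, 1, 3` for `k = 5` and `0, 2, 4` for larger `k`.
  rcases eq_or_lt_of_le hk with rfl | hk
  · have h1 := key 0 2 (by omega) (by omega) (by omega) (by omega)
    have h2 := key 2 4 (by omega) (by omega) (by omega) (by omega)
    have h3 := key 1 4 (by omega) (by omega) (by omega) (by omega)
    have h4 := key 1 3 (by omega) (by omega) (by omega) (by omega)
    have h5 := key 0 3 (by omega) (by omega) (by omega) (by omega)
    omega
  · have h1 := key 0 2 (by omega) (by omega) (by omega) (by omega)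
    have h2 := key 2 4 (by omega) (by omega) (by omega) (by omega)
    have h3 := key 0 4 (by omega) (by omega) (by omega) (by omega)
    omega

/-- The last vertex of the path that lies on an induced cycle would have only one neighbour on
the cycle. -/
theorem not_isIndContained_pathGraph_of_cycleGraph {k m : ℕ} (hk : 3 ≤ k) :
    ¬ (SimpleGraph.cycleGraph k).IsIndContained (SimpleGraph.pathGraph m) := by
  rintro ⟨e⟩
  obtain ⟨k, rfl⟩ := Nat.exists_eq_add_of_le' hk
  obtain ⟨i, hi⟩ := Finite.exists_max fun i => (e i : ℕ)
  have h1 : (SimpleGraph.cycleGraph (k + 1 + 2)).Adj i (i + 1) := by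
    simp [SimpleGraph.cycleGraph_adj]
  have h2 : (SimpleGraph.cycleGraph (k + 1 + 2)).Adj i (i - 1) := by
    simp [SimpleGraph.cycleGraph_adj]
  rw [← e.map_adj_iff, SimpleGraph.pathGraph_adj] at h1 h2
  have h3 := hi (i + 1)
  have h4 := hi (i - 1)
  -- Both neighbours of the last vertex `i` are sent to its predecessor on the path.
  have h5 : i + 1 = i - 1 := e.injective (Fin.ext (by omega))
  rw [sub_eq_add_neg, add_right_inj, Fin.ext_iff] at h5
  simp [Fin.val_neg'] at h5

theorem isWeaklyChordal_compl_pathGraph (m : ℕ) : IsWeaklyChordal (SimpleGraph.pathGraph m)ᶜ := by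
  intro k hk
  refine ⟨fun ⟨e⟩ => ?_, fun ⟨e⟩ => ?_⟩
  · refine not_isIndContained_pathGraph_of_cycleGraph_compl (m := m) hk ⟨e.toEmbedding, ?_⟩
    intro i j
    by_cases hij : i = j
    · simp [hij]
    · have := e.map_adj_iff (v := i) (w := j)
      simp_all [e.injective.ne hij, ← this]
  · refine not_isIndContained_pathGraph_of_cycleGraph (m := m) (by omega) ⟨e.toEmbedding, ?_⟩
    intro i j
    by_cases hij : i = j
    · simp [hij]
    · have := e.map_adj_iff (v := i) (w := j)
      simp_all [e.injective.ne hij]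
      exact not_iff_not.1 this

/-! ### Doubling a graph over a star -/

/-- The double of `Γ` over the star of `v`: two copies of `Γ` glued along `v` and its neighbours.
A glued vertex `x` is encoded as `(x, false)`; the other vertices carry a copy label. -/
def SimpleGraph.double {V : Type*} (Γ : SimpleGraph V) (v : V) :
    SimpleGraph {p : V × Bool // p.2 = true → ¬ (p.1 = v ∨ Γ.Adj v p.1)} where
  Adj p q := Γ.Adj p.1.1 q.1.1 ∧
    (p.1.2 = q.1.2 ∨ (p.1.1 = v ∨ Γ.Adj v p.1.1) ∨ (q.1.1 = v ∨ Γ.Adj v q.1.1))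
  symm := ⟨fun p q h => ⟨h.1.symm, by tauto⟩⟩
  loopless := ⟨fun p h => Γ.irrefl h.1⟩

theorem SimpleGraph.nonempty_embedding_double {U V : Type*} {Ω : SimpleGraph U}
    {Γ : SimpleGraph V} {v : V} (p : U → V × Bool) (hinj : Function.Injective p)
    (hp : ∀ i, (p i).2 = true → ¬ ((p i).1 = v ∨ Γ.Adj v (p i).1))
    (hadj : ∀ i j, (Γ.Adj (p i).1 (p j).1 ∧ ((p i).2 = (p j).2 ∨
      ((p i).1 = v ∨ Γ.Adj v (p i).1) ∨ ((p j).1 = v ∨ Γ.Adj v (p j).1))) ↔ Ω.Adj i j) :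
    Nonempty (Ω ↪g Γ.double v) :=
  ⟨⟨⟨fun i => ⟨p i, hp i⟩, fun _ _ h => hinj (Subtype.mk.inj h)⟩, hadj _ _⟩⟩

namespace PCGroup.Double

open Classical in
/-- The generator of the double given by a vertex of `Γ` and a label, which is ignored on the
star of `v`. -/
noncomputable def gen {V : Type*} (Γ : SimpleGraph V) (v x : V) (b : Bool) :
    PCGroup (Γ.double v) :=
  PresentedGroup.of
    ⟨(x, if x = v ∨ Γ.Adj v x then false else b), by intro h; split_ifs at h; assumption⟩

variable {V : Type*} {Γ : SimpleGraph V} {v : V}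

theorem of_eq_gen (p) : PresentedGroup.of p = gen Γ v p.1.1 p.1.2 := by
  obtain ⟨⟨x, b⟩, h⟩ := p
  unfold gen
  congr 3
  cases b
  · simp
  · simp [h rfl]

theorem gen_eq_of_star {x : V} (hx : x = v ∨ Γ.Adj v x) (b c : Bool) :
    gen Γ v x b = gen Γ v x c := by
  simp [gen, hx]

theorem commute_gen {x y : V} (h : Γ.Adj x y) (b : Bool) :
    Commute (gen Γ v x b) (gen Γ v y b) := by
  refine commute_of_adj ⟨h, ?_⟩
  dsimp only
  split_ifs <;> tauto

theorem commute_gen_star {x : V} (hx : x = v ∨ Γ.Adj v x) (b c : Bool) :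
    Commute (gen Γ v v b) (gen Γ v x c) := by
  rcases hx with rfl | hx
  · rw [gen_eq_of_star (.inl rfl) b c]
  · rw [gen_eq_of_star (.inl rfl) b c]
    exact commute_gen hx c

/-- The homomorphism out of the group of the double given by images for all labelled vertices,
where the label must not matter on the star of `v`. -/
def liftDouble {G : Type*} [Group G] (f : V → Bool → G)
    (hf : ∀ x y b, Γ.Adj x y → Commute (f x b) (f y b))
    (hstar : ∀ x, x = v ∨ Γ.Adj v x → f x true = f x false) : PCGroup (Γ.double v) →* G :=
  lift (fun p => f p.1.1 p.1.2) (by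
    have hstar' (x) (hx : x = v ∨ Γ.Adj v x) (b c) : f x b = f x c := by
      cases b <;> cases c <;> simp [hstar x hx]
    rintro p q ⟨hadj, h | h | h⟩
    · rw [h]; exact hf _ _ _ hadj
    · rw [hstar' _ h _ q.1.2]; exact hf _ _ _ hadj
    · rw [hstar' _ h _ p.1.2]; exact hf _ _ _ hadj)

@[simp]
theorem liftDouble_gen {G : Type*} [Group G] (f : V → Bool → G)
    (hf : ∀ x y b, Γ.Adj x y → Commute (f x b) (f y b))
    (hstar : ∀ x, x = v ∨ Γ.Adj v x → f x true = f x false) (x : V) (b : Bool) :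
    liftDouble f hf hstar (gen Γ v x b) = f x b := by
  rw [gen, liftDouble, lift_of]
  dsimp only
  split_ifs with hx
  · cases b <;> simp [hstar x hx]
  · rfl

theorem conj_gen_star {x : V} (hx : x = v ∨ Γ.Adj v x) (b c : Bool) :
    gen Γ v v false * gen Γ v x b * (gen Γ v v false)⁻¹ = gen Γ v x c := by
  rw [gen_eq_of_star hx b c, (commute_gen_star hx false c).eq, mul_inv_cancel_right]

/-- The endomorphism that conjugation by a square root of the generator `v` would induce: it takes
the first copy to the second, and the second to the conjugate of the first by `v`. -/
noncomputable def shift (Γ : SimpleGraph V) (v : V) :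
    PCGroup (Γ.double v) →* PCGroup (Γ.double v) :=
  liftDouble (fun x b => bif b then gen Γ v v false * gen Γ v x false * (gen Γ v v false)⁻¹
      else gen Γ v x true)
    (by
      rintro x y (_ | _) hxy
      · exact commute_gen hxy true
      · exact (Commute.conj_iff _).2 (commute_gen hxy false))
    (fun x hx => conj_gen_star hx _ _)

theorem shift_gen_false (x : V) : shift Γ v (gen Γ v x false) = gen Γ v x true :=
  liftDouble_gen _ _ _ x false

theorem shift_gen_true (x : V) : shift Γ v (gen Γ v x true) =
    gen Γ v v false * gen Γ v x false * (gen Γ v v false)⁻¹ :=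
  liftDouble_gen _ _ _ x true

theorem shift_gen_star {x : V} (hx : x = v ∨ Γ.Adj v x) (b : Bool) :
    shift Γ v (gen Γ v x b) = gen Γ v x b := by
  rw [gen_eq_of_star hx b false, shift_gen_false, gen_eq_of_star hx]

theorem shift_shift (g : PCGroup (Γ.double v)) :
    shift Γ v (shift Γ v g) = gen Γ v v false * g * (gen Γ v v false)⁻¹ := by
  suffices h : (shift Γ v).comp (shift Γ v) = (MulAut.conj (gen Γ v v false)).toMonoidHom from
    DFunLike.congr_fun h g
  apply PresentedGroup.ext
  intro p
  rw [of_eq_gen]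
  rcases p.1.2 with _ | _
  · simp [shift_gen_false, shift_gen_true]
  · simp [shift_gen_false, shift_gen_true, shift_gen_star]

theorem shift_bijective : Function.Bijective (shift Γ v) := by
  have h : Function.Bijective (shift Γ v ∘ shift Γ v) := by
    convert (MulAut.conj (gen Γ v v false)).bijective
    ext g
    simp [shift_shift]
  exact ⟨h.1.of_comp, h.2.of_comp⟩

/-- The square root of the generator `v`, as a permutation of the two cosets of the group of the
double in the extension of that group by the square root. -/
noncomputable def sqrtPerm (Γ : SimpleGraph V) (v : V) :
    Equiv.Perm (PCGroup (Γ.double v) × Bool) :=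
  Equiv.ofBijective (fun q => (shift Γ v q.1 * bif q.2 then gen Γ v v false else 1, !q.2)) (by
    constructor
    · rintro ⟨g, _ | _⟩ ⟨h, _ | _⟩ hgh <;> simp_all [shift_bijective.1.eq_iff]
    · rintro ⟨g, _ | _⟩
      · obtain ⟨h, hh⟩ := shift_bijective.2 (g * (gen Γ v v false)⁻¹)
        exact ⟨(h, true), by simp [hh]⟩
      · obtain ⟨h, hh⟩ := shift_bijective.2 g
        exact ⟨(h, false), by simp [hh]⟩)

theorem sqrtPerm_apply (q : PCGroup (Γ.double v) × Bool) :
    sqrtPerm Γ v q = (shift Γ v q.1 * bif q.2 then gen Γ v v false else 1, !q.2) :=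
  rfl

/-- Left multiplication on each of the two cosets. -/
def mulLeftPerm (G : Type*) [Group G] : G →* Equiv.Perm (G × Bool) where
  toFun g := (Equiv.mulLeft g).prodCongr (Equiv.refl Bool)
  map_one' := by ext <;> simp
  map_mul' g h := by ext <;> simp [mul_assoc]

@[simp]
theorem mulLeftPerm_apply {G : Type*} [Group G] (g : G) (q : G × Bool) :
    mulLeftPerm G g q = (g * q.1, q.2) :=
  rfl

theorem sqrtPerm_commute {x : V} (hx : Γ.Adj v x) :
    Commute (sqrtPerm Γ v) (mulLeftPerm _ (gen Γ v x false)) := by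
  apply Equiv.ext
  rintro ⟨g, b⟩
  simp [sqrtPerm_apply, shift_gen_star (.inr hx), mul_assoc]

open Classical in
/-- The action of `𝔾(Γ)` on the two cosets. -/
noncomputable def action (Γ : SimpleGraph V) (v : V) :
    PCGroup Γ →* Equiv.Perm (PCGroup (Γ.double v) × Bool) :=
  lift (fun x => if x = v then sqrtPerm Γ v else mulLeftPerm _ (gen Γ v x false)) (by
    intro x y h
    split_ifs with hx hy hy
    · exact .refl _
    · exact sqrtPerm_commute (hx ▸ h)
    · exact (sqrtPerm_commute (hy ▸ h.symm)).symm
    · exact (commute_gen h false).map _)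

open Classical in
/-- The homomorphism from the group of the double to `𝔾(Γ)` that squares `v`, is the identity on
the first copy, and conjugates the second copy by `v`. -/
noncomputable def toPCGroup (Γ : SimpleGraph V) (v : V) : PCGroup (Γ.double v) →* PCGroup Γ :=
  liftDouble (fun x b => if x = v then PresentedGroup.of v ^ 2 else
      bif b then PresentedGroup.of v * PresentedGroup.of x * (PresentedGroup.of v)⁻¹
      else PresentedGroup.of x)
    (by
      have key (x : V) (b : Bool) (h : Γ.Adj v x) :
          (bif b then PresentedGroup.of v * PresentedGroup.of x * (PresentedGroup.of v)⁻¹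
            else PresentedGroup.of x : PCGroup Γ) = PresentedGroup.of x := by
        cases b
        · rfl
        · simp [(commute_of_adj h).eq]
      intro x y b h
      split_ifs with hx hy hy
      · exact .refl _
      · subst hx
        rw [key y b h]
        exact (commute_of_adj h).pow_left 2
      · subst hy
        rw [key x b h.symm]
        exact (commute_of_adj h).pow_right 2
      · cases b
        · exact commute_of_adj h
        · exact (Commute.conj_iff _).2 (commute_of_adj h))
    (by
      rintro x (rfl | hx)
      · simp
      · simp [(commute_of_adj hx).eq])

theorem action_toPCGroup (d g : PCGroup (Γ.double v)) :
    action Γ v (toPCGroup Γ v d) (g, false) = (d * g, false) := by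
  let H : Subgroup (PCGroup (Γ.double v)) :=
    { carrier := {d | ∀ g, action Γ v (toPCGroup Γ v d) (g, false) = (d * g, false)}
      one_mem' := by simp
      mul_mem' := by
        intro a b ha hb g
        simp [hb g, ha (b * g), mul_assoc]
      inv_mem' := by
        intro a ha g
        rw [map_inv, map_inv, Equiv.Perm.inv_eq_iff_eq, ha, mul_inv_cancel_left] }
  refine PresentedGroup.generated_by _ H (fun p g => ?_) d g
  rw [of_eq_gen]
  generalize p.1.1 = x
  generalize p.1.2 = b
  by_cases hx : x = v
  · subst hx
    rw [gen_eq_of_star (.inl rfl) b false]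
    simp [toPCGroup, action, sqrtPerm_apply, pow_two, shift_shift]
  · cases b
    · simp [toPCGroup, action, hx]
    · obtain ⟨h, hh⟩ := shift_bijective.2 (g * (gen Γ v v false)⁻¹)
      have hs : sqrtPerm Γ v (h, true) = (g, false) := by simp [sqrtPerm_apply, hh]
      have hs' : (sqrtPerm Γ v).symm (g, false) = (h, true) := by
        rw [Equiv.symm_apply_eq, hs]
      simp [toPCGroup, action, hx, hs', sqrtPerm_apply, shift_gen_false, hh, mul_assoc]

/-- The group of the double of `Γ` over a star embeds in `𝔾(Γ)`: its image in `𝔾(Γ)` acts on the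
first coset by left multiplication. -/
theorem groupEmbeds (Γ : SimpleGraph V) (v : V) :
    GroupEmbeds (PCGroup (Γ.double v)) (PCGroup Γ) := by
  refine ⟨toPCGroup Γ v, fun a b h => ?_⟩
  have ha := action_toPCGroup a 1
  rw [h, action_toPCGroup] at ha
  simpa using ha.symm

end PCGroup.Double

/-! ### Cycle groups in the pentagon group -/

/-- The cycle on `0, …, n - 1` together with a vertex `n` joined to `0` and `3`, so that for
`n ≥ 5` the vertices `0, 1, 2, 3, n` span an induced pentagon. -/
def eared (n : ℕ) : SimpleGraph (Fin (n + 1)) :=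
  SimpleGraph.fromRel fun i j => i.val + 1 = j.val ∧ j.val < n ∨ i.val = 0 ∧ j.val + 1 = n ∨
    j.val = n ∧ (i.val = 0 ∨ i.val = 3)

theorem eared_adj {n : ℕ} (i j : Fin (n + 1)) : (eared n).Adj i j ↔ i.val ≠ j.val ∧
    ((i.val + 1 = j.val ∧ j.val < n ∨ i.val = 0 ∧ j.val + 1 = n ∨
      j.val = n ∧ (i.val = 0 ∨ i.val = 3)) ∨
    (j.val + 1 = i.val ∧ i.val < n ∨ j.val = 0 ∧ i.val + 1 = n ∨
      i.val = n ∧ (j.val = 0 ∨ j.val = 3))) := by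
  rw [eared, SimpleGraph.fromRel_adj, Ne, Fin.ext_iff]

theorem cycleGraph_embedding_eared {n : ℕ} (hn : 5 ≤ n) :
    Nonempty (SimpleGraph.cycleGraph n ↪g eared n) := by
  refine ⟨⟨⟨Fin.castSucc, Fin.castSucc_injective n⟩, @fun i j => ?_⟩⟩
  change (eared n).Adj i.castSucc j.castSucc ↔ _
  rw [eared_adj, SimpleGraph.cycleGraph_adj', Fin.val_sub, Fin.val_sub]
  obtain ⟨i, hi⟩ := i
  obtain ⟨j, hj⟩ := j
  dsimp only [Fin.val_castSucc]
  have key (a b : ℕ) (ha : a < n) (hb : b < n) :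
      (n - b + a) % n = if b ≤ a then a - b else n - b + a := by
    split_ifs with h
    · rw [show n - b + a = (a - b) + n by omega, Nat.add_mod_right, Nat.mod_eq_of_lt (by omega)]
    · rw [Nat.mod_eq_of_lt (by omega)]
  rw [key i j hi hj, key j i hj hi]
  split_ifs <;> omega

/-- The double of the pentagon over the star of `0` is a hexagon together with the vertex `0`, joined
to two opposite vertices of the hexagon. -/
theorem eared_six_embedding :
    Nonempty (eared 6 ↪g (SimpleGraph.cycleGraph 5).double 0) := by
  let p : Fin 7 → Fin 5 × Bool :=
    ![(1, false), (2, false), (3, false), (4, false), (3, true), (2, true), (0, false)]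
  have hp : ∀ i, (p i).2 = true → ¬ ((p i).1 = 0 ∨ (SimpleGraph.cycleGraph 5).Adj 0 (p i).1) := by
    simp only [SimpleGraph.cycleGraph_adj']
    decide
  have hinj : Function.Injective p := by decide
  refine SimpleGraph.nonempty_embedding_double p hinj hp ?_
  simp only [eared_adj, SimpleGraph.cycleGraph_adj']
  decide

/-- Doubling over the star of `1` replaces `1` in the cycle by the other two vertices `n` and `3`
of the second copy of the pentagon; the old vertex `1` takes over the role of `n`. -/
theorem eared_succ_embedding {n : ℕ} (hn : 6 ≤ n) :
    Nonempty (eared (n + 1) ↪g (eared n).double ⟨1, by omega⟩) := by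
  have hstar (x : Fin (n + 1)) :
      (x = ⟨1, by omega⟩ ∨ (eared n).Adj ⟨1, by omega⟩ x) ↔ x.val ≤ 2 := by
    rw [eared_adj, Fin.ext_iff]
    dsimp only
    omega
  let pos (i : ℕ) : ℕ :=
    if i = 0 then 0 else if i = 1 then n else if i = 2 then 3 else if i ≤ n then i - 1 else 1
  have hpos (i : ℕ) (hi : i < n + 1 + 1) : i = 0 ∧ pos i = 0 ∨ i = 1 ∧ pos i = n ∨
      i = 2 ∧ pos i = 3 ∨ 3 ≤ i ∧ pos i + 1 = i ∧ pos i < n ∨ i = n + 1 ∧ pos i = 1 := by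
    dsimp only [pos]
    split_ifs <;> omega
  have hlt (i : ℕ) (hi : i < n + 1 + 1) : pos i < n + 1 := by
    have := hpos i hi
    omega
  clear_value pos
  refine SimpleGraph.nonempty_embedding_double
    (fun i => (⟨pos i, hlt i i.2⟩, decide (i.val = 1 ∨ i.val = 2))) ?_ ?_ ?_
  · rintro ⟨i, hi⟩ ⟨j, hj⟩ h
    simp only [Prod.mk.injEq, Fin.mk.injEq, decide_eq_decide] at h
    have := hpos i hi
    have := hpos j hj
    rw [Fin.mk.injEq]
    omega
  · rintro ⟨i, hi⟩ h
    simp only [hstar, decide_eq_true_eq] at h ⊢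
    have := hpos i hi
    omega
  · rintro ⟨i, hi⟩ ⟨j, hj⟩
    simp only [hstar, decide_eq_decide, iff_iff_and_or_not_and_not (a := _ ∨ _)]
    simp only [eared_adj]
    have hi' := hpos i hi
    have hj' := hpos j hj
    generalize pos i = a at *
    generalize pos j = b at *
    rcases hi' with h | h | h | h | h <;> rcases hj' with h' | h' | h' | h' | h' <;>
      (constructor <;> intro hadj <;> omega)

theorem groupEmbeds_eared {n : ℕ} (hn : 6 ≤ n) :
    GroupEmbeds (PCGroup (eared n)) (PCGroup (SimpleGraph.cycleGraph 5)) := by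
  induction n, hn using Nat.le_induction with
  | base =>
    obtain ⟨e⟩ := eared_six_embedding
    exact (PCGroup.groupEmbeds_of_embedding e).trans (PCGroup.Double.groupEmbeds _ _)
  | succ n hn ih =>
    obtain ⟨e⟩ := eared_succ_embedding hn
    exact ((PCGroup.groupEmbeds_of_embedding e).trans (PCGroup.Double.groupEmbeds _ _)).trans ih

theorem groupEmbeds_cycleGraph {n : ℕ} (hn : 5 ≤ n) :
    GroupEmbeds (PCGroup (SimpleGraph.cycleGraph n)) (PCGroup (SimpleGraph.cycleGraph 5)) := by
  rcases hn.eq_or_lt with rfl | h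
  · exact ⟨MonoidHom.id _, Function.injective_id⟩
  · obtain ⟨e⟩ := cycleGraph_embedding_eared hn
    exact (PCGroup.groupEmbeds_of_embedding e).trans (groupEmbeds_eared h)

theorem corollary4p4 (n m : ℕ) (hn : 5 ≤ n) (hm : 7 ≤ m) :
    GroupEmbeds (PCGroup (SimpleGraph.cycleGraph n)) (PCGroup (SimpleGraph.cycleGraph 5)) ∧
    Nonempty (PCGroup (SimpleGraph.cycleGraph 5) ≃* PCGroup (SimpleGraph.cycleGraph 5)ᶜ) ∧
    GroupEmbeds (PCGroup (pathWithEdges 7)ᶜ) (PCGroup (pathWithEdges m)ᶜ) ∧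
    GroupEmbeds (PCGroup (SimpleGraph.cycleGraph n)) (PCGroup (pathWithEdges m)ᶜ) ∧
    IsWeaklyChordal (pathWithEdges m)ᶜ := by
  obtain ⟨e₁⟩ := cycleGraph_five_iso_compl
  obtain ⟨e₂⟩ := pathCompl_embedding_of_le hm
  have h₁ := groupEmbeds_cycleGraph hn
  have h₂ := PCGroup.groupEmbeds_of_embedding e₂
  exact ⟨h₁, ⟨PCGroup.congr e₁⟩, h₂, (h₁.trans groupEmbeds_cycleGraph_five_pathCompl).trans h₂,
    isWeaklyChordal_compl_pathGraph _⟩
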